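/- Let $r \ge 4$ be an integer and let $G$ be a finite forest (acyclic simple graph) with at least one edge. The $r$-expansion $G^+$ of $G$ is the $r$-uniform hypergraph with edge set $\{e \cup S_e : e \in E(G)\}$, where each $S_e$ is a set of $r-2$ new vertices, disjoint from $V(G)$, and $S_e \cap S_{e'} = \emptyset$ for $e \ne e'$. Let $\mathrm{ex}_r(n, G^+)$ be the maximum number of edges of an $r$-uniform hypergraph on $n$ vertices that contains no copy of $G^+$, and let $\sigma(G^+)$ be the minimum size of a crosscut of $G^+$, that is, of a set of vertices of $G^+$ that contains exactly one vertex of every edge. Then, with $r$ and $G$ fixed and $n \to \infty$, $$\mathrm{ex}_r(n, G^+) = (\sigma(G^+) - 1)\binom{n}{r-1} + o\left(\binom{n}{r-1}\right).$$ In particular, if $\sigma(G^+) \ge 2$, then $\mathrm{ex}_r(n, G^+) \sim (\sigma(G^+) - 1)\binom{n}{r-1}$, that is, the ratio of the two sides tends to $1$. -/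

import Mathlib

open Filter Asymptotics

/- A hypergraph on a finite vertex type `U` is given by its edge set, a `Finset (Finset U)`; it is
an `r`-graph if all its edges have exactly `r` elements. -/

/-- `H` contains a copy of `F`: some injection of the vertices of `F` into the vertices of `H`
sends every edge of `F` to an edge of `H`. -/
def ContainsCopy {U W : Type*} (F : Finset (Finset U)) (H : Finset (Finset W)) : Prop :=
  ∃ f : U ↪ W, ∀ e ∈ F, e.map f ∈ H

open Classical in
/-- `turanNumber r n F`, usually written `ex_r(n, F)`: the maximum number of edges of an `r`-graph
on `n` vertices that does not contain a copy of `F`. -/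
noncomputable def turanNumber (r n : ℕ) {U : Type*} (F : Finset (Finset U)) : ℕ :=
  {H ∈ (Finset.powersetCard r (Finset.univ : Finset (Fin n))).powerset |
    ¬ ContainsCopy F H}.sup Finset.card

/-- A crosscut of `F`: a set of vertices that contains exactly one vertex of every edge. -/
def IsCrosscut {U : Type*} (F : Finset (Finset U)) (X : Finset U) : Prop :=
  ∀ e ∈ F, ∃! x, x ∈ e ∧ x ∈ X

/-- The minimum size `σ(F)` of a crosscut of `F`, for hypergraphs `F` that have a crosscut. -/
noncomputable def crosscutNumber {U : Type*} (F : Finset (Finset U)) : ℕ :=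
  sInf {k | ∃ X : Finset U, IsCrosscut F X ∧ X.card = k}

open Classical in
/-- The `r`-expansion `G⁺` of a graph `G` (for `r ≥ 2`). Its vertices are those of `G` together with
`r - 2` new vertices `(e, i)` for every edge `e` of `G`; its edges are the sets `e ∪ S_e` for the
edges `e` of `G`, where `S_e` is the set of the new vertices that belong to `e`. -/
noncomputable def expansion (r : ℕ) {V : Type*} [Fintype V] (G : SimpleGraph V) :
    Finset (Finset (V ⊕ (G.edgeSet × Fin (r - 2)))) :=
  Finset.univ.image fun e : G.edgeSet =>
    (e : Sym2 V).toFinset.disjSum (({e} : Finset G.edgeSet) ×ˢ Finset.univ)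

/-- Every expansion with at least one new vertex per edge has a crosscut, so that
`crosscutNumber` is a genuine minimum for it. -/
theorem exists_isCrosscut_expansion {r : ℕ} (hr : 3 ≤ r) {V : Type*} [Fintype V]
    (G : SimpleGraph V) : ∃ X, IsCrosscut (expansion r G) X := by
  classical
  refine ⟨Finset.univ.image fun e : G.edgeSet => Sum.inr (e, ⟨0, by omega⟩), ?_⟩
  intro f hf
  obtain ⟨e, -, rfl⟩ := Finset.mem_image.1 hf
  refine ⟨Sum.inr (e, ⟨0, by omega⟩), by simp, ?_⟩
  rintro x ⟨hx, hX⟩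
  obtain ⟨e', -, rfl⟩ := Finset.mem_image.1 hX
  simp at hx
  simp [hx]

/-!
Write `σ` for the crosscut number of the expansion `G⁺` of the forest `G`, and `s = r - 1`.

*Lower bound.* The `r`-sets that meet a fixed set of `σ - 1` vertices in exactly one vertex contain
no copy of `G⁺`, as the vertices mapped into the fixed set would form a crosscut with fewer than `σ`
vertices (`crosscutNumber_le_of_containsCopy`, `le_turanNumber`).

*Upper bound.* Let `H` contain no copy of `G⁺`. Removing again and again the `s`-sets that have
fewer than `σ` completions to an edge costs at most `(σ - 1) * n.choose s` edges and leaves `H'`,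
all sets of whose shadow `D` have at least `σ` completions. A hypergraph in which every set of the
shadow has many completions ("full", `IsFull`) contains `G⁺`, by embedding the forest leaf by leaf
(`exists_forest_embedding`, `IsFull.containsCopy_expansion`); hence `|H'| = O(|D|)`, and it remains
to show that `|D| = o(n ^ s)`.

Choose a set `L e` of `σ` completions for each `e ∈ D`, and call a pair `(a, v)` heavy if `v ∈ L e`
for more than `α * n ^ (s - 1)` of the sets `e ∈ D` that contain `a`; there are `O(n)` heavy pairs.
Since `s ≥ 3`, for every `v ∈ L e` either two vertices of `e` are light with `v`, or two are heavy.

* If two vertices of `e` are light with some `v ∈ L e`, for many `e`, then these two vertices can be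
  used for the vertices of `G`: in the greedy embedding, lightness ensures that the completion `v`
  of a new edge can be taken to be new (`card_le_of_not_containsCopy_of_light`).
* If two vertices of `e` are heavy with `v ∈ L e` then, up to few exceptions, `v` lies in more than
  `β * n` heavy pairs. There is only a bounded number of such `v`; let `S` be the set of them.
* So almost all other `e` have `L e ⊆ S`, and boundedly many classes of them share the same `L e`.
  In a class with more than a constant times `n ^ (s - 1)` sets there is a full `s`-graph, in which
  `G⁺` without a minimum crosscut can be embedded; mapping the crosscut to `L e` completes the copy
  (`IsFull.containsCopy_expansion_of_isCrosscut`,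
  `card_le_of_not_containsCopy_of_common_completions`).

The three cases are put together in `card_le_of_not_containsCopy` and
`exists_card_le_of_not_containsCopy`.
-/

/-! ### Finite forests -/

theorem SimpleGraph.IsAcyclic.exists_forall_adj_eq {V : Type*} [Finite V] [Nonempty V]
    {G : SimpleGraph V} (hG : G.IsAcyclic) :
    ∃ v, ∀ x y, G.Adj v x → G.Adj v y → x = y := by
  classical
  have := Fintype.ofFinite V
  rcases subsingleton_or_nontrivial V with h | h
  · exact ⟨Classical.arbitrary V, fun x y _ _ => Subsingleton.elim x y⟩
  -- a maximal acyclic supergraph is a spanning tree, which has a leaf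
  obtain ⟨T, hGT, hT⟩ := exists_maximal_isAcyclic_of_le_isAcyclic (le_top : G ≤ ⊤) hG
  have hTree : T.IsTree := maximal_isAcyclic_iff_isTree.1 (by simpa using hT)
  obtain ⟨v, hv⟩ := hTree.exists_vert_degree_one_of_nontrivial
  obtain ⟨w, -, hw⟩ := SimpleGraph.degree_eq_one_iff_existsUnique_adj.1 hv
  exact ⟨v, fun x y hx hy => (hw x (hGT hx)).trans (hw y (hGT hy)).symm⟩

theorem SimpleGraph.IsAcyclic.exists_mem_forall_adj_eq {V : Type*} {G : SimpleGraph V}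
    (hG : G.IsAcyclic) {S : Finset V} (hS : S.Nonempty) :
    ∃ v ∈ S, ∀ x ∈ S, ∀ y ∈ S, G.Adj v x → G.Adj v y → x = y := by
  have : Nonempty (S : Set V) := hS.to_subtype
  obtain ⟨⟨v, hv⟩, h⟩ := (hG.induce (S : Set V)).exists_forall_adj_eq
  refine ⟨v, hv, fun x hx y hy hvx hvy => ?_⟩
  simpa using h ⟨x, hx⟩ ⟨y, hy⟩ (by simpa using hvx) (by simpa using hvy)

/-! ### Greedy embeddings -/

/-- Greedy embedding of a forest. Read `P a b T` as "`{a, b} ∪ T` is an available edge with the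
two distinguished vertices `a` and `b`". If every distinguished vertex `a` has, for every small set
`U` not containing it, an available edge whose other vertices avoid `U`, then the forest can be
embedded leaf by leaf, together with disjoint sets `T` completing its edges to available ones. -/
theorem exists_forest_embedding {V W : Type*} [Fintype V] {G : SimpleGraph V} (hG : G.IsAcyclic)
    {P : W → W → Finset W → Prop} (hsymm : ∀ {a b T}, P a b T → P b a T)
    (hdis : ∀ {a b T}, P a b T → a ≠ b ∧ a ∉ T) {t : ℕ} (ht : ∀ {a b T}, P a b T → T.card ≤ t)
    {M : ℕ} (hM : Fintype.card V + Nat.card (Sym2 V) * t ≤ M)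
    (hext : ∀ {a b T}, P a b T → ∀ U : Finset W, U.card ≤ M → a ∉ U →
      ∃ b' T', P a b' T' ∧ b' ∉ U ∧ Disjoint T' U)
    (hne : ∃ a b T, P a b T) :
    ∃ (φ : V → W) (T : Sym2 V → Finset W), Function.Injective φ ∧ (∀ e v, φ v ∉ T e) ∧
      (∀ e e', e ≠ e' → Disjoint (T e) (T e')) ∧ (∀ v, ∃ b T, P (φ v) b T) ∧
      ∀ x y, G.Adj x y → P (φ x) (φ y) (T s(x, y)) := by
  classical
  suffices h : ∀ (n : ℕ) (S : Finset V), S.card = n →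
      ∃ (φ : V → W) (T : Sym2 V → Finset W), Set.InjOn φ S ∧ (∀ e, ∀ v ∈ S, φ v ∉ T e) ∧
      (∀ e e', e ≠ e' → Disjoint (T e) (T e')) ∧ (∀ e, (T e).card ≤ t) ∧
      (∀ v ∈ S, ∃ b T, P (φ v) b T) ∧
      ∀ x ∈ S, ∀ y ∈ S, G.Adj x y → P (φ x) (φ y) (T s(x, y)) by
    obtain ⟨φ, T, h1, h2, h3, -, h4, h5⟩ := h _ Finset.univ rfl
    exact ⟨φ, T, by simpa using h1, by simpa using h2, h3, by simpa using h4, by simpa using h5⟩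
  intro n
  induction n with
  | zero =>
    intro S hS
    obtain rfl := Finset.card_eq_zero.1 hS
    obtain ⟨a, -⟩ := hne
    exact ⟨fun _ => a, fun _ => ∅, by simp, by simp, by simp, by simp, by simp, by simp⟩
  | succ n ih =>
    intro S hS
    obtain ⟨v, hvS, hleaf⟩ := hG.exists_mem_forall_adj_eq (S := S) (Finset.card_pos.1 (by omega))
    obtain ⟨φ, T, h1, h2, h3, h4, h5, h6⟩ := ih (S.erase v) (by simp [hvS, hS])
    set S' := S.erase v with hS'
    have hvS' : v ∉ S' := by simp [hS']
    have hins : S = insert v S' := by simp [hS', hvS]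
    set U : Finset W := S'.image φ ∪ Finset.univ.biUnion T with hU
    have hUM : U.card ≤ M := by
      refine (Finset.card_union_le _ _).trans (le_trans (add_le_add ?_ ?_) hM)
      · exact Finset.card_image_le.trans (Finset.card_le_univ _)
      · refine Finset.card_biUnion_le.trans ((Finset.sum_le_card_nsmul _ _ t (by simp [h4])).trans ?_)
        simp [Nat.card_eq_fintype_card]
    have hφU : ∀ x ∈ S', φ x ∈ U := fun x hx =>
      Finset.mem_union_left _ (Finset.mem_image_of_mem _ hx)
    have hTU : ∀ e, T e ⊆ U := fun e =>
      (Finset.subset_biUnion_of_mem T (Finset.mem_univ e)).trans Finset.subset_union_right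
    have hne' : ∀ x ∈ S', x ≠ v := fun x hx h => hvS' (h ▸ hx)
    have hupd : ∀ (b : W), ∀ x ∈ S', Function.update φ v b x = φ x := fun b x hx =>
      Function.update_of_ne (hne' x hx) _ _
    have hinj : ∀ b ∉ U, Set.InjOn (Function.update φ v b) S := by
      intro b hb
      rw [hins, Finset.coe_insert, Set.injOn_insert (by simpa using hvS')]
      refine ⟨h1.congr fun x hx => (hupd b x hx).symm, ?_⟩
      rintro ⟨x, hx, hxb⟩
      rw [hupd b x hx, Function.update_self] at hxb
      exact hb (hxb ▸ hφU x hx)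
    by_cases hnb : ∃ x ∈ S', G.Adj v x
    · -- `v` is joined to a single embedded vertex `x`: use an available edge at `φ x`
      obtain ⟨x, hx, hvx⟩ := hnb
      obtain ⟨b₀, T₀, hP₀⟩ := h5 x hx
      obtain ⟨b, T', hP, hb, hT'⟩ := hext hP₀ (U.erase (φ x))
        ((Finset.card_le_card (Finset.erase_subset _ _)).trans hUM) (by simp)
      have hbU : b ∉ U := fun h => hb (Finset.mem_erase.2 ⟨(hdis hP).1.symm, h⟩)
      have hT'U : Disjoint T' U := by
        rw [Finset.disjoint_left] at hT' ⊢
        exact fun w hw hwU => hT' hw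
          (Finset.mem_erase.2 ⟨fun h => (hdis hP).2 (h ▸ hw), hwU⟩)
      refine ⟨Function.update φ v b, Function.update T s(v, x) T', hinj b hbU, ?_, ?_, ?_, ?_, ?_⟩
      · intro e w hw
        have key : ∀ e', Function.update φ v b w ∉ T e' ∧ Function.update φ v b w ∉ T' := by
          intro e'
          rw [hins, Finset.mem_insert] at hw
          rcases hw with rfl | hw
          · rw [Function.update_self]
            exact ⟨fun h => hbU (hTU _ h), (hdis (hsymm hP)).2⟩
          · rw [hupd b w hw]
            exact ⟨h2 e' w hw, fun h => Finset.disjoint_left.1 hT'U h (hφU w hw)⟩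
        by_cases he : e = s(v, x)
        · subst he
          rw [Function.update_self]
          exact (key s(v, x)).2
        · rw [Function.update_of_ne he]
          exact (key e).1
      · intro e e' hee'
        by_cases he : e = s(v, x)
        · subst he
          rw [Function.update_self, Function.update_of_ne hee'.symm]
          exact hT'U.mono_right (hTU _)
        · rw [Function.update_of_ne he]
          by_cases he' : e' = s(v, x)
          · subst he'
            rw [Function.update_self]
            exact (hT'U.mono_right (hTU _)).symm
          · rw [Function.update_of_ne he']
            exact h3 _ _ hee'
      · intro e
        by_cases he : e = s(v, x)
        · subst he
          rw [Function.update_self]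
          exact ht hP
        · rw [Function.update_of_ne he]
          exact h4 e
      · intro w hw
        rw [hins, Finset.mem_insert] at hw
        rcases hw with rfl | hw
        · rw [Function.update_self]
          exact ⟨_, _, hsymm hP⟩
        · rw [hupd b w hw]
          exact h5 w hw
      · -- by the choice of `v`, its only neighbour in `S` is `x`
        have hv : ∀ y ∈ S, G.Adj v y → y = x := fun y hy hvy =>
          hleaf y hy x (Finset.mem_of_mem_erase hx) hvy hvx
        intro y hy z hz hyz
        by_cases hyv : y = v
        · subst hyv
          obtain rfl := hv z hz hyz
          rw [Function.update_self, Function.update_self, hupd b z hx]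
          exact hsymm hP
        · by_cases hzv : z = v
          · subst hzv
            obtain rfl := hv y hy hyz.symm
            rw [Function.update_self, hupd b y hx, Sym2.eq_swap, Function.update_self]
            exact hP
          · have hy' : y ∈ S' := Finset.mem_erase.2 ⟨hyv, hy⟩
            have hz' : z ∈ S' := Finset.mem_erase.2 ⟨hzv, hz⟩
            rw [hupd b y hy', hupd b z hz', Function.update_of_ne]
            · exact h6 y hy' z hz' hyz
            · intro h
              have : v ∈ s(y, z) := h ▸ Sym2.mem_mk_left v x
              rcases Sym2.mem_iff.1 this with rfl | rfl
              exacts [hyv rfl, hzv rfl]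
    · -- the second vertex of an available edge at `a` can be taken outside `U`
      push Not at hnb
      obtain ⟨a, b, T₀, hP₀⟩ := hne
      obtain ⟨b', T₁, hP₁, hb', -⟩ := hext hP₀ (U.erase a)
        ((Finset.card_le_card (Finset.erase_subset _ _)).trans hUM) (by simp)
      have hbU : b' ∉ U := fun h => hb' (Finset.mem_erase.2 ⟨(hdis hP₁).1.symm, h⟩)
      refine ⟨Function.update φ v b', T, hinj b' hbU, ?_, h3, h4, ?_, ?_⟩
      · intro e w hw
        rw [hins, Finset.mem_insert] at hw
        rcases hw with rfl | hw
        · rw [Function.update_self]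
          exact fun h => hbU (hTU _ h)
        · rw [hupd b' w hw]
          exact h2 e w hw
      · intro w hw
        rw [hins, Finset.mem_insert] at hw
        rcases hw with rfl | hw
        · rw [Function.update_self]
          exact ⟨_, _, hsymm hP₁⟩
        · rw [hupd b' w hw]
          exact h5 w hw
      · intro y hy z hz hyz
        rw [hins, Finset.mem_insert] at hy hz
        rcases hy with rfl | hy <;> rcases hz with rfl | hz
        · exact absurd hyz (G.irrefl)
        · exact absurd hyz (hnb z hz)
        · exact absurd hyz.symm (hnb y hy)
        · rw [hupd b' y hy, hupd b' z hz]
          exact h6 y hy z hz hyz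

/-- Greedy choice of pairwise disjoint sets of prescribed kinds. -/
theorem exists_disjoint_choice {ι W : Type*} [Fintype ι] {Q : ι → Finset W → Prop} {t : ℕ}
    (ht : ∀ {j T}, Q j T → T.card ≤ t) (U₀ : Finset W)
    (hQ : ∀ (j : ι) (U : Finset W), U.card ≤ U₀.card + Fintype.card ι * t →
      ∃ T, Q j T ∧ Disjoint T U) :
    ∃ T : ι → Finset W, (∀ j, Q j (T j)) ∧ (∀ j, Disjoint (T j) U₀) ∧
      ∀ i j, i ≠ j → Disjoint (T i) (T j) := by
  classical
  suffices h : ∀ J : Finset ι, ∃ T : ι → Finset W, (∀ j ∈ J, Q j (T j)) ∧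
      (∀ j ∈ J, Disjoint (T j) U₀) ∧ ∀ i ∈ J, ∀ j ∈ J, i ≠ j → Disjoint (T i) (T j) by
    obtain ⟨T, h1, h2, h3⟩ := h Finset.univ
    exact ⟨T, by simpa using h1, by simpa using h2, by simpa using h3⟩
  intro J
  induction J using Finset.induction_on with
  | empty => exact ⟨fun _ => ∅, by simp, by simp, by simp⟩
  | insert j J hj ih =>
    obtain ⟨T, h1, h2, h3⟩ := ih
    obtain ⟨T', hT', hd⟩ := hQ j (U₀ ∪ J.biUnion T) <| by
      refine (Finset.card_union_le _ _).trans (Nat.add_le_add_left ?_ _)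
      refine Finset.card_biUnion_le.trans
        ((Finset.sum_le_card_nsmul _ _ t fun i hi => ht (h1 i hi)).trans ?_)
      simpa using Nat.mul_le_mul_right t (Finset.card_le_univ J)
    rw [Finset.disjoint_union_right, Finset.disjoint_biUnion_right] at hd
    have hne : ∀ i ∈ J, i ≠ j := fun i hi h => hj (h ▸ hi)
    refine ⟨Function.update T j T', ?_, ?_, ?_⟩
    · intro i hi
      rcases Finset.mem_insert.1 hi with rfl | hi
      · simpa using hT'
      · simpa [hne i hi] using h1 i hi
    · intro i hi
      rcases Finset.mem_insert.1 hi with rfl | hi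
      · simpa using hd.1
      · simpa [hne i hi] using h2 i hi
    · intro i hi k hk hik
      rcases Finset.mem_insert.1 hi with rfl | hi' <;> rcases Finset.mem_insert.1 hk with rfl | hk'
      · exact absurd rfl hik
      · simpa [hne k hk'] using hd.2 k hk'
      · simpa [hne i hi'] using (hd.2 i hi').symm
      · simpa [hne i hi', hne k hk'] using h3 i hi' k hk' hik

/-- To exhibit a copy of an expansion it suffices to give the images of the vertices of the graph
and, for every edge, the image of its set of new vertices. -/
theorem containsCopy_expansion {r : ℕ} {V W : Type*} [Fintype V] [DecidableEq W]
    {G : SimpleGraph V} {H : Finset (Finset W)} {φ : V → W} (hφ : Function.Injective φ)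
    {T : G.edgeSet → Finset W} (hcard : ∀ e, (T e).card = r - 2) (hφT : ∀ e v, φ v ∉ T e)
    (hT : ∀ e e', e ≠ e' → Disjoint (T e) (T e'))
    (hmem : ∀ x y (h : G.Adj x y), insert (φ x) (insert (φ y) (T ⟨s(x, y), h⟩)) ∈ H) :
    ContainsCopy (expansion r G) H := by
  classical
  let g : ∀ e, Fin (r - 2) ≃ T e := fun e => ((T e).equivFinOfCardEq (hcard e)).symm
  refine ⟨⟨Sum.elim φ fun p => (g p.1 p.2 : W), ?_⟩, ?_⟩
  · refine hφ.sumElim ?_ fun v p h => hφT p.1 v (h ▸ (g p.1 p.2).2)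
    rintro ⟨e, i⟩ ⟨e', i'⟩ h
    dsimp only at h
    obtain rfl : e = e' := by
      by_contra hne
      exact Finset.disjoint_left.1 (hT e e' hne) (g e i).2 (h ▸ (g e' i').2)
    rw [(g e).injective (Subtype.ext h)]
  · intro f hf
    obtain ⟨⟨e, he⟩, -, rfl⟩ := Finset.mem_image.1 hf
    induction e using Sym2.ind with
    | _ x y =>
      convert hmem x y he using 1
      ext w
      simp only [Finset.mem_map, Function.Embedding.coeFn_mk, Finset.mem_disjSum, Finset.mem_insert,
        Finset.mem_product, Finset.mem_singleton, Finset.mem_univ, and_true, Sym2.mem_toFinset,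
        Sym2.mem_iff]
      constructor
      · rintro ⟨u, ⟨v, hv, rfl⟩ | ⟨⟨e', i⟩, rfl, rfl⟩, rfl⟩
        · rcases hv with rfl | rfl <;> simp
        · exact Or.inr (Or.inr (g _ i).2)
      · rintro (rfl | rfl | hw)
        · exact ⟨Sum.inl x, by simp⟩
        · exact ⟨Sum.inl y, by simp⟩
        · refine ⟨Sum.inr (⟨s(x, y), he⟩, (g _).symm ⟨w, hw⟩), Or.inr ⟨_, rfl, rfl⟩, ?_⟩
          simp

/-- Deleting again and again the objects incident to a key of degree at most `d` removes at most
`d` objects per key, and leaves only keys of degree more than `d`. -/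
theorem exists_subset_forall_lt_degree {A K : Type*} [DecidableEq K] (inc : A → Finset K) (d : ℕ)
    (Ks : Finset K) (S : Finset A) (h : ∀ a ∈ S, inc a ⊆ Ks) :
    ∃ S' ⊆ S, S.card ≤ S'.card + d * Ks.card ∧
      ∀ a ∈ S', ∀ k ∈ inc a, d < (S'.filter (k ∈ inc ·)).card := by
  induction hn : Ks.card generalizing Ks S with
  | zero =>
    refine ⟨S, subset_rfl, by simp, fun a ha k hk => ?_⟩
    rw [Finset.card_eq_zero] at hn
    subst hn
    simpa using h a ha hk
  | succ n ih =>
    by_cases hS : ∀ a ∈ S, ∀ k ∈ inc a, d < (S.filter (k ∈ inc ·)).card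
    · exact ⟨S, subset_rfl, by simp, hS⟩
    push Not at hS
    obtain ⟨a, ha, k, hk, hd⟩ := hS
    obtain ⟨S', hS', hc, hS''⟩ := ih (Ks.erase k) (S.filter (k ∉ inc ·)) (by
      intro b hb
      rw [Finset.mem_filter] at hb
      exact fun l hl => Finset.mem_erase.2 ⟨fun e => hb.2 (e ▸ hl), h b hb.1 hl⟩) (by
      rw [Finset.card_erase_of_mem (h a ha hk), hn, Nat.add_sub_cancel])
    refine ⟨S', hS'.trans (Finset.filter_subset _ _), ?_, hS''⟩
    have := Finset.card_filter_add_card_filter_not (s := S) (k ∈ inc ·)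
    linarith [mul_add d n 1]

/-! ### Full hypergraphs -/

/-- `D` is `d`-full if every set obtained by removing one vertex from an edge of `D` lies in more
than `d` edges of `D`. -/
def IsFull {W : Type*} [DecidableEq W] (d : ℕ) (D : Finset (Finset W)) : Prop :=
  ∀ E ∈ D, ∀ u ∈ E, d < (D.filter (E.erase u ⊆ ·)).card

/-- The full part is obtained by removing the sets of the shadow that lie in at most `d` edges. -/
theorem exists_isFull {W : Type*} [DecidableEq W] (d : ℕ) (D : Finset (Finset W)) :
    ∃ D' ⊆ D, IsFull d D' ∧ D.card ≤ D'.card + d * D.shadow.card := by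
  obtain ⟨D', hD', hc, h⟩ := exists_subset_forall_lt_degree
    (fun E : Finset W => E.image E.erase) d D.shadow D (by
      intro E hE k hk
      obtain ⟨u, hu, rfl⟩ := Finset.mem_image.1 hk
      exact Finset.erase_mem_shadow hE hu)
  refine ⟨D', hD', fun E hE u hu => (h E hE _ (Finset.mem_image_of_mem _ hu)).trans_le ?_, hc⟩
  refine Finset.card_le_card (Finset.monotone_filter_right _ fun E' _ hE' => ?_)
  obtain ⟨u', hu', h'⟩ := Finset.mem_image.1 hE'
  exact h' ▸ Finset.erase_subset _ _

/-- In a full hypergraph, the vertices of an edge can be moved out of a small set `U` one by one. -/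
theorem IsFull.exists_disjoint {W : Type*} [DecidableEq W] {d s : ℕ} {D : Finset (Finset W)}
    (hD : IsFull d D) (hs : (D : Set (Finset W)).Sized s) {E K U : Finset W} (hE : E ∈ D)
    (hKE : K ⊆ E) (hKU : Disjoint K U) (hU : U.card ≤ d) :
    ∃ E' ∈ D, K ⊆ E' ∧ Disjoint E' U := by
  induction hn : (E ∩ U).card using Nat.strong_induction_on generalizing E with
  | _ n ih =>
    by_cases hEU : Disjoint E U
    · exact ⟨E, hE, hKE, hEU⟩
    obtain ⟨u, huE, huU⟩ := Finset.not_disjoint_iff.1 hEU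
    obtain ⟨E', hE', hne⟩ : ∃ E' ∈ D.filter (E.erase u ⊆ ·),
        E' ∉ U.image fun w => insert w (E.erase u) := by
      by_contra! hcon
      exact absurd ((Finset.card_le_card hcon).trans (Finset.card_image_le.trans hU))
        (not_le.2 (hD E hE u huE))
    rw [Finset.mem_filter] at hE'
    obtain ⟨hE'D, hsub⟩ := hE'
    obtain ⟨w, hw⟩ : ∃ w, E' \ E.erase u = {w} := by
      rw [← Finset.card_eq_one, Finset.card_sdiff_of_subset hsub, Finset.card_erase_of_mem huE,
        hs hE'D, hs hE]
      have : 0 < E.card := Finset.card_pos.2 ⟨u, huE⟩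
      have := hs hE
      omega
    have hE'eq : insert w (E.erase u) = E' := by
      rw [Finset.insert_eq, ← hw, Finset.sdiff_union_of_subset hsub]
    have hwU : w ∉ U := fun h => hne (Finset.mem_image.2 ⟨w, h, hE'eq⟩)
    refine ih _ ?_ hE'D (fun k hk => hsub (Finset.mem_erase.2 ⟨?_, hKE hk⟩)) rfl
    · rw [← hn, ← hE'eq, Finset.insert_inter_of_notMem hwU, Finset.erase_inter]
      exact Finset.card_erase_lt_of_mem (Finset.mem_inter.2 ⟨huE, huU⟩)
    · rintro rfl
      exact Finset.disjoint_left.1 hKU hk huU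

/-- In a full `r`-graph every pair of vertices of an edge can be distinguished, so that greedy
embedding works for every forest. -/
theorem IsFull.containsCopy_expansion {V W : Type*} [Fintype V] [DecidableEq W] {G : SimpleGraph V}
    (hG : G.IsAcyclic) {r d : ℕ} (hr : 2 ≤ r) {D : Finset (Finset W)} (hD : IsFull d D)
    (hs : (D : Set (Finset W)).Sized r) (hne : D.Nonempty)
    (hd : Fintype.card V + Nat.card (Sym2 V) * (r - 2) ≤ d) :
    ContainsCopy (expansion r G) D := by
  have hpair : ∀ {a : W} {E : Finset W}, E ∈ D → a ∈ E → ∃ b ∈ E, a ≠ b := by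
    intro a E hE ha
    obtain ⟨b, hb, hba⟩ := Finset.exists_mem_ne (by rw [hs hE]; omega) a
    exact ⟨b, hb, hba.symm⟩
  have hins : ∀ {a b : W} {E : Finset W}, a ∈ E → b ∈ E → a ≠ b →
      insert a (insert b ((E.erase a).erase b)) = E := by
    intro a b E ha hb hab
    rw [Finset.insert_erase (Finset.mem_erase.2 ⟨hab.symm, hb⟩), Finset.insert_erase ha]
  have hcard : ∀ {a b : W} {T : Finset W}, (a ≠ b ∧ a ∉ T ∧ b ∉ T ∧ insert a (insert b T) ∈ D) →
      T.card = r - 2 := by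
    rintro a b T ⟨hab, ha, hb, h⟩
    have := hs h
    rw [Finset.card_insert_of_notMem (by simp [hab, ha]), Finset.card_insert_of_notMem hb] at this
    omega
  obtain ⟨φ, T, h1, h2, h3, -, h5⟩ := exists_forest_embedding hG
    (P := fun a b T => a ≠ b ∧ a ∉ T ∧ b ∉ T ∧ insert a (insert b T) ∈ D) (t := r - 2)
    (fun ⟨hab, ha, hb, h⟩ => ⟨hab.symm, hb, ha, by rwa [Finset.insert_comm]⟩)
    (fun h => ⟨h.1, h.2.1⟩) (fun h => (hcard h).le) hd (by
      rintro a b T ⟨-, -, -, h⟩ U hU haU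
      obtain ⟨E, hE, haE, hEU⟩ := hD.exists_disjoint hs h (K := {a}) (by simp) (by simpa) hU
      rw [Finset.singleton_subset_iff] at haE
      obtain ⟨b', hb', hab⟩ := hpair hE haE
      refine ⟨b', (E.erase a).erase b', ⟨hab, by simp, by simp, ?_⟩,
        Finset.disjoint_left.1 hEU hb', ?_⟩
      · rwa [hins haE hb' hab]
      · exact hEU.mono_left ((Finset.erase_subset _ _).trans (Finset.erase_subset _ _))) (by
      obtain ⟨E, hE⟩ := hne
      obtain ⟨a, ha⟩ : E.Nonempty := Finset.card_pos.1 (by rw [hs hE]; omega)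
      obtain ⟨b, hb, hab⟩ := hpair hE ha
      exact ⟨a, b, (E.erase a).erase b, hab, by simp, by simp, by rwa [hins ha hb hab]⟩)
  refine _root_.containsCopy_expansion (φ := φ) (T := fun e => T e) h1 ?_ (fun e v => h2 e v)
    (fun e e' h => h3 _ _ (Subtype.coe_injective.ne h)) (fun x y h => (h5 x y h).2.2.2)
  rintro ⟨e, he⟩
  induction e using Sym2.ind with
  | _ x y => exact hcard (h5 x y he)

theorem IsCrosscut.adj_cases {r : ℕ} {V : Type*} [Fintype V] {G : SimpleGraph V}
    {X : Finset (V ⊕ (G.edgeSet × Fin (r - 2)))} (hX : IsCrosscut (expansion r G) X) {x y : V}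
    (h : G.Adj x y) :
    (Sum.inl x ∈ X ∧ Sum.inl y ∉ X ∧ ∀ i, Sum.inr (⟨s(x, y), h⟩, i) ∉ X) ∨
    (Sum.inl x ∉ X ∧ Sum.inl y ∈ X ∧ ∀ i, Sum.inr (⟨s(x, y), h⟩, i) ∉ X) ∨
    (Sum.inl x ∉ X ∧ Sum.inl y ∉ X ∧ ∃ i, Sum.inr (⟨s(x, y), h⟩, i) ∈ X) := by
  classical
  obtain ⟨z, ⟨hz, hzX⟩, huniq⟩ := hX _ (Finset.mem_image_of_mem _ (Finset.mem_univ ⟨s(x, y), h⟩))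
  have hinl : ∀ v, Sum.inl v ∈ X → (v = x ∨ v = y) → Sum.inl v = z := fun v hv hvxy =>
    huniq _ ⟨by simpa using hvxy, hv⟩
  have hinr : ∀ i, Sum.inr (⟨s(x, y), h⟩, i) ∈ X → Sum.inr (⟨s(x, y), h⟩, i) = z := fun i hi =>
    huniq _ ⟨by simp, hi⟩
  rcases z with v | ⟨e, i⟩
  · have hv : v = x ∨ v = y := by simpa using hz
    rcases hv with rfl | rfl
    · exact Or.inl ⟨hzX, fun hy => h.ne (Sum.inl_injective (hinl y hy (Or.inr rfl))).symm,
        fun i hi => by simpa using hinr i hi⟩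
    · exact Or.inr (Or.inl ⟨fun hx => h.ne (Sum.inl_injective (hinl x hx (Or.inl rfl))), hzX,
        fun i hi => by simpa using hinr i hi⟩)
  · have he : e = ⟨s(x, y), h⟩ := by simpa [eq_comm] using hz
    subst he
    exact Or.inr (Or.inr ⟨fun hx => by simpa using hinl x hx (Or.inl rfl),
      fun hy => by simpa using hinl y hy (Or.inr rfl), i, hzX⟩)

/-- If each of the sets of a full `(r - 1)`-graph `D` can be completed to an edge of `H` by each
of the points `ψ x` for `x` in a crosscut `X` of the expansion of a forest, then `H` contains the
expansion: the crosscut is mapped by `ψ`, and what is left of the edges is embedded in `D`. -/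
theorem IsFull.containsCopy_expansion_of_isCrosscut {V W : Type*} [Fintype V] [DecidableEq W]
    {G : SimpleGraph V} (hG : G.IsAcyclic) {r d : ℕ} (hr : 3 ≤ r) {D H : Finset (Finset W)}
    (hD : IsFull d D) (hs : (D : Set (Finset W)).Sized (r - 1)) (hne : D.Nonempty)
    (hd : Fintype.card V + Nat.card G.edgeSet * (r - 1) ≤ d)
    {X : Finset (V ⊕ (G.edgeSet × Fin (r - 2)))} (hX : IsCrosscut (expansion r G) X)
    {ψ : V ⊕ (G.edgeSet × Fin (r - 2)) → W} (hψ : Set.InjOn ψ X)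
    (hψD : ∀ E ∈ D, ∀ x ∈ X, ψ x ∉ E) (hH : ∀ E ∈ D, ∀ x ∈ X, insert (ψ x) E ∈ H) :
    ContainsCopy (expansion r G) H := by
  classical
  have := Fintype.ofFinite G.edgeSet
  rw [Nat.card_eq_fintype_card] at hd
  -- embed the whole forest in the graph of the pairs covered by `D`
  obtain ⟨φ₀, _, hφ₀, -, -, hmark, hadj⟩ := exists_forest_embedding hG
    (P := fun a b T => a ≠ b ∧ T = ∅ ∧ ∃ E ∈ D, a ∈ E ∧ b ∈ E) (t := 0) (M := d)
    (fun ⟨hab, hT, E, hE, ha, hb⟩ => ⟨hab.symm, hT, E, hE, hb, ha⟩)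
    (by rintro a b T ⟨hab, rfl, -⟩; exact ⟨hab, by simp⟩)
    (by rintro a b T ⟨-, rfl, -⟩; simp) (by simp; omega) (by
      rintro a b T ⟨-, -, E, hE, ha, -⟩ U hU haU
      obtain ⟨E', hE', haE', hEU⟩ := hD.exists_disjoint hs hE (K := {a}) (by simpa) (by simpa) hU
      rw [Finset.singleton_subset_iff] at haE'
      obtain ⟨b', hb', hab⟩ := Finset.exists_mem_ne (by rw [hs hE']; omega) a
      exact ⟨b', ∅, ⟨hab.symm, rfl, E', hE', haE', hb'⟩, Finset.disjoint_left.1 hEU hb',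
        by simp⟩) (by
      obtain ⟨E, hE⟩ := hne
      obtain ⟨a, ha⟩ : E.Nonempty := Finset.card_pos.1 (by rw [hs hE]; omega)
      obtain ⟨b, hb, hab⟩ := Finset.exists_mem_ne (by rw [hs hE]; omega) a
      exact ⟨a, b, ∅, hab.symm, rfl, E, hE, ha, hb⟩)
  -- the part of an edge of the forest that is not in the crosscut
  let K : G.edgeSet → Finset W := fun e =>
    ((e : Sym2 V).toFinset.filter fun v => Sum.inl v ∉ X).image φ₀
  have hKmem : ∀ {x y : V} {h : G.Adj x y} {w : W}, w ∈ K ⟨s(x, y), h⟩ ↔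
      (w = φ₀ x ∧ Sum.inl x ∉ X) ∨ (w = φ₀ y ∧ Sum.inl y ∉ X) := by
    intro x y h w
    simp only [K, Finset.mem_image, Finset.mem_filter, Sym2.mem_toFinset, Sym2.mem_iff]
    constructor
    · rintro ⟨v, ⟨rfl | rfl, hv⟩, rfl⟩
      exacts [Or.inl ⟨rfl, hv⟩, Or.inr ⟨rfl, hv⟩]
    · rintro (⟨rfl, hv⟩ | ⟨rfl, hv⟩)
      exacts [⟨x, ⟨Or.inl rfl, hv⟩, rfl⟩, ⟨y, ⟨Or.inr rfl, hv⟩, rfl⟩]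
  have hK : ∀ e, ∃ E ∈ D, K e ⊆ E := by
    rintro ⟨e, he⟩
    induction e using Sym2.ind with
    | _ x y =>
      obtain ⟨-, -, E, hE, hx, hy⟩ := hadj x y he
      refine ⟨E, hE, fun w hw => ?_⟩
      rcases hKmem.1 hw with ⟨rfl, -⟩ | ⟨rfl, -⟩ <;> assumption
  obtain ⟨T₀, hQ, hT₀φ, hT₀⟩ := exists_disjoint_choice
    (Q := fun (e : G.edgeSet) T => ∃ E ∈ D, K e ⊆ E ∧ T = E \ K e) (t := r - 1)
    (by
      rintro e T ⟨E, hE, -, rfl⟩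
      exact (Finset.card_le_card Finset.sdiff_subset).trans (hs hE).le)
    (Finset.univ.image φ₀) (by
      intro e U hU
      obtain ⟨E, hE, hKE⟩ := hK e
      obtain ⟨E', hE', hKE', hEU⟩ := hD.exists_disjoint hs hE hKE (U := U \ K e)
        Finset.disjoint_sdiff (by
          refine (Finset.card_le_card Finset.sdiff_subset).trans (hU.trans (le_trans ?_ hd))
          gcongr
          exact Finset.card_image_le)
      refine ⟨E' \ K e, ⟨E', hE', hKE', rfl⟩, ?_⟩
      rw [Finset.disjoint_left] at hEU ⊢
      intro w hw hwU
      rw [Finset.mem_sdiff] at hw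
      exact hEU hw.1 (Finset.mem_sdiff.2 ⟨hwU, hw.2⟩))
  have hψφ : ∀ x ∈ X, ∀ v, ψ x ≠ φ₀ v := by
    intro x hx v h
    obtain ⟨b, T, -, -, E, hE, hv, -⟩ := hmark v
    exact hψD E hE x hx (h ▸ hv)
  have hψT : ∀ x ∈ X, ∀ e, ψ x ∉ T₀ e := by
    intro x hx e h
    obtain ⟨E, hE, -, hT⟩ := hQ e
    rw [hT] at h
    exact hψD E hE x hx (Finset.mem_sdiff.1 h).1
  have hφT : ∀ v e, φ₀ v ∉ T₀ e := fun v e h =>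
    Finset.disjoint_left.1 (hT₀φ e) h (Finset.mem_image_of_mem _ (Finset.mem_univ v))
  let φ : V → W := fun v => if Sum.inl v ∈ X then ψ (Sum.inl v) else φ₀ v
  let T : G.edgeSet → Finset W := fun e =>
    if h : ∃ i, Sum.inr (e, i) ∈ X then insert (ψ (Sum.inr (e, h.choose))) (T₀ e) else T₀ e
  have hTmem : ∀ {e w}, w ∈ T e → w ∈ T₀ e ∨ ∃ i, Sum.inr (e, i) ∈ X ∧ w = ψ (Sum.inr (e, i)) := by
    intro e w hw
    by_cases h : ∃ i, Sum.inr (e, i) ∈ X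
    · simp only [T, dif_pos h, Finset.mem_insert] at hw
      exact hw.symm.imp id fun h' => ⟨_, h.choose_spec, h'⟩
    · simp only [T, dif_neg h] at hw
      exact Or.inl hw
  have key : ∀ x y (h : G.Adj x y), (T ⟨s(x, y), h⟩).card = r - 2 ∧
      insert (φ x) (insert (φ y) (T ⟨s(x, y), h⟩)) ∈ H := by
    intro x y h
    obtain ⟨E, hE, hKE, hTE⟩ := hQ ⟨s(x, y), h⟩
    have hcard : (T₀ ⟨s(x, y), h⟩).card = r - 1 - (K ⟨s(x, y), h⟩).card := by
      rw [hTE, Finset.card_sdiff_of_subset hKE, hs hE]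
    have hEK : K ⟨s(x, y), h⟩ ∪ T₀ ⟨s(x, y), h⟩ = E := by
      rw [hTE, Finset.union_sdiff_of_subset hKE]
    rcases hX.adj_cases h with ⟨hx, hy, hi⟩ | ⟨hx, hy, hi⟩ | ⟨hx, hy, hi⟩
    · have hKeq : K ⟨s(x, y), h⟩ = {φ₀ y} := by
        ext w
        rw [hKmem]
        simp [hx, hy]
      rw [hKeq] at hcard hEK
      have hTe : T ⟨s(x, y), h⟩ = T₀ ⟨s(x, y), h⟩ := dif_neg (by simpa using hi)
      refine ⟨by rw [hTe, hcard, Finset.card_singleton]; omega, ?_⟩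
      rw [hTe, show φ x = ψ (Sum.inl x) from if_pos hx, show φ y = φ₀ y from if_neg hy,
        Finset.insert_eq (φ₀ y), hEK]
      exact hH E hE _ hx
    · have hKeq : K ⟨s(x, y), h⟩ = {φ₀ x} := by
        ext w
        rw [hKmem]
        simp [hx, hy]
      rw [hKeq] at hcard hEK
      have hTe : T ⟨s(x, y), h⟩ = T₀ ⟨s(x, y), h⟩ := dif_neg (by simpa using hi)
      refine ⟨by rw [hTe, hcard, Finset.card_singleton]; omega, ?_⟩
      rw [hTe, show φ y = ψ (Sum.inl y) from if_pos hy, show φ x = φ₀ x from if_neg hx,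
        Finset.insert_comm, Finset.insert_eq (φ₀ x), hEK]
      exact hH E hE _ hy
    · have hKeq : K ⟨s(x, y), h⟩ = {φ₀ x, φ₀ y} := by
        ext w
        rw [hKmem]
        simp [hx, hy]
      rw [hKeq] at hcard hEK
      rw [Finset.card_pair (hφ₀.ne h.ne)] at hcard
      have hTe : T ⟨s(x, y), h⟩ = insert (ψ (Sum.inr (⟨s(x, y), h⟩, hi.choose)))
        (T₀ ⟨s(x, y), h⟩) := dif_pos hi
      refine ⟨?_, ?_⟩
      · rw [hTe, Finset.card_insert_of_notMem (hψT _ hi.choose_spec _), hcard]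
        omega
      · rw [hTe, show φ y = φ₀ y from if_neg hy, show φ x = φ₀ x from if_neg hx,
          Finset.insert_comm (φ₀ y), Finset.insert_comm (φ₀ x)]
        rw [Finset.insert_union, ← Finset.insert_eq] at hEK
        rw [hEK]
        exact hH E hE _ hi.choose_spec
  refine _root_.containsCopy_expansion (φ := φ) (T := T) ?_ ?_ ?_ ?_ fun x y h => (key x y h).2
  · intro v v' h
    by_cases hv : Sum.inl v ∈ X <;> by_cases hv' : Sum.inl v' ∈ X <;>
      simp only [φ, hv, hv', if_true, if_false] at h
    · exact Sum.inl_injective (hψ hv hv' h)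
    · exact absurd h (hψφ _ hv _)
    · exact absurd h.symm (hψφ _ hv' _)
    · exact hφ₀ h
  · rintro ⟨e, he⟩
    induction e using Sym2.ind with
    | _ x y => exact (key x y he).1
  · intro e v hv
    by_cases hvX : Sum.inl v ∈ X <;> simp only [φ, hvX, if_true, if_false] at hv
    · rcases hTmem hv with hv | ⟨i, hi, h⟩
      · exact hψT _ hvX _ hv
      · simpa using hψ hvX hi h
    · rcases hTmem hv with hv | ⟨i, hi, h⟩
      · exact hφT _ _ hv
      · exact hψφ _ hi _ h.symm
  · intro e e' hee'
    rw [Finset.disjoint_left]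
    intro w hw hw'
    rcases hTmem hw with hw | ⟨i, hi, rfl⟩
    · rcases hTmem hw' with hw' | ⟨i', hi', rfl⟩
      · exact Finset.disjoint_left.1 (hT₀ e e' hee') hw hw'
      · exact hψT _ hi' _ hw
    · rcases hTmem hw' with hw' | ⟨i', hi', h⟩
      · exact hψT _ hi _ hw'
      · have := hψ hi hi' h
        simp only [Sum.inr.injEq, Prod.mk.injEq] at this
        exact hee' this.1

/-! ### Hypergraphs with many completions of each edge -/

theorem Set.Sized.card_filter_superset_le {W : Type*} [Fintype W] [DecidableEq W] {s : ℕ}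
    {D : Finset (Finset W)} (hs : (D : Set (Finset W)).Sized s) (K : Finset W) :
    (D.filter (K ⊆ ·)).card ≤ Fintype.card W ^ (s - K.card) := by
  have h : (D.filter (K ⊆ ·)).card ≤
      (Finset.powersetCard (s - K.card) (Finset.univ : Finset W)).card := by
    refine Finset.card_le_card_of_injOn (· \ K) ?_ ?_
    · intro E hE
      rw [Finset.mem_coe, Finset.mem_filter] at hE
      simp [Finset.mem_powersetCard, Finset.card_sdiff_of_subset hE.2, hs hE.1]
    · intro E hE E' hE' h
      rw [Finset.mem_coe, Finset.mem_filter] at hE hE'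
      dsimp only at h
      rw [← Finset.union_sdiff_of_subset hE.2, h, Finset.union_sdiff_of_subset hE'.2]
  rw [Finset.card_powersetCard, Finset.card_univ] at h
  exact h.trans (Nat.choose_le_pow _ _)

/-- The pairs `(e, v) ∈ A` stand for the edges `insert v e` of `H`, each with two distinguished
vertices, the elements of `inc (e, v) ⊆ e`. If no distinguished vertex `a` of `(e, v)` lies in many
sets of `D` that are completed by `v`, then a large `A` yields a greedy embedding. -/
theorem card_le_of_not_containsCopy_of_light {V W : Type*} [Fintype V] [Fintype W] [DecidableEq W]
    {G : SimpleGraph V} (hG : G.IsAcyclic) {r σ η : ℕ} (hr : 3 ≤ r) {D H : Finset (Finset W)}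
    (hs : (D : Set (Finset W)).Sized (r - 1)) {L : Finset W → Finset W}
    (hLc : ∀ e ∈ D, (L e).card ≤ σ) (hLd : ∀ e ∈ D, ∀ v ∈ L e, v ∉ e)
    (hLH : ∀ e ∈ D, ∀ v ∈ L e, insert v e ∈ H)
    {A : Finset (Finset W × W)} (hA : ∀ p ∈ A, p.1 ∈ D ∧ p.2 ∈ L p.1)
    {inc : Finset W × W → Finset W} (hinc : ∀ p ∈ A, inc p ⊆ p.1 ∧ (inc p).card = 2 ∧
      ∀ a ∈ inc p, (D.filter fun e => a ∈ e ∧ p.2 ∈ L e).card ≤ η)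
    (hH : ¬ ContainsCopy (expansion r G) H) :
    A.card ≤ (Fintype.card V + Nat.card (Sym2 V) * (r - 2)) *
      (Fintype.card W ^ (r - 3) * σ + η) * Fintype.card W := by
  set M := Fintype.card V + Nat.card (Sym2 V) * (r - 2) with hM
  obtain ⟨A', hA'A, hcard, hdeg⟩ := exists_subset_forall_lt_degree inc
    (M * (Fintype.card W ^ (r - 3) * σ + η)) Finset.univ A (fun _ _ => Finset.subset_univ _)
  rw [Finset.card_univ] at hcard
  suffices h : A' = ∅ by simpa [h] using hcard
  by_contra hne
  apply hH
  have hPcard : ∀ {a b : W} {T : Finset W}, (∃ e v, (e, v) ∈ A' ∧ inc (e, v) = {a, b} ∧ a ≠ b ∧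
      T = insert v (e \ {a, b})) → T.card = r - 2 := by
    rintro a b T ⟨e, v, he, hi, hab, rfl⟩
    have h1 := hinc _ (hA'A he)
    have h2 := hA _ (hA'A he)
    rw [hi] at h1
    rw [Finset.card_insert_of_notMem, Finset.card_sdiff_of_subset h1.1, hs h2.1,
      Finset.card_pair hab]
    · omega
    · exact fun h => hLd _ h2.1 _ h2.2 (Finset.mem_sdiff.1 h).1
  have hpair : ∀ {e v a}, (e, v) ∈ A' → a ∈ inc (e, v) → ∃ b, inc (e, v) = {a, b} ∧ a ≠ b := by
    intro e v a he ha
    obtain ⟨x, y, hxy, hi⟩ := Finset.card_eq_two.1 (hinc _ (hA'A he)).2.1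
    rw [hi, Finset.mem_insert, Finset.mem_singleton] at ha
    rcases ha with rfl | rfl
    · exact ⟨y, hi, hxy⟩
    · exact ⟨x, by rw [hi, Finset.pair_comm], hxy.symm⟩
  obtain ⟨φ, T, h1, h2, h3, -, h5⟩ := exists_forest_embedding hG
    (P := fun a b T => ∃ e v, (e, v) ∈ A' ∧ inc (e, v) = {a, b} ∧ a ≠ b ∧
      T = insert v (e \ {a, b})) (t := r - 2) (M := M)
    (fun ⟨e, v, he, hi, hab, hT⟩ => ⟨e, v, he, by rw [hi, Finset.pair_comm], hab.symm,
      by rw [hT, Finset.pair_comm]⟩)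
    (by
      rintro a b T ⟨e, v, he, hi, hab, rfl⟩
      have h1 := hinc _ (hA'A he)
      have h2 := hA _ (hA'A he)
      rw [hi] at h1
      refine ⟨hab, ?_⟩
      simp only [Finset.mem_insert, Finset.mem_sdiff, Finset.mem_singleton, true_or, not_true,
        and_false, or_false]
      exact fun h => hLd _ h2.1 _ h2.2 (h ▸ h1.1 (by simp)))
    (fun h => (hPcard h).le) le_rfl (by
      rintro a b T ⟨e₀, v₀, he₀, hi₀, -, -⟩ U hU haU
      -- few of the pairs with distinguished vertex `a` meet `U`
      obtain ⟨⟨e, v⟩, he, hev⟩ : ∃ p ∈ A'.filter (a ∈ inc ·),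
          p ∉ U.biUnion fun u =>
            ((D.filter (({a, u} : Finset W) ⊆ ·)).sigma L).image
              (fun q : (_ : Finset W) × W => (q.1, q.2)) ∪
            (A'.filter fun q => a ∈ inc q ∧ q.2 = u) := by
        by_contra! hcon
        have hbound := (hdeg _ he₀ a (by simp [hi₀])).trans_le (Finset.card_le_card hcon)
        refine absurd hbound (not_lt.2 (Finset.card_biUnion_le.trans
          ((Finset.sum_le_card_nsmul _ _ (Fintype.card W ^ (r - 3) * σ + η) ?_).trans ?_)))
        · intro u hu
          refine (Finset.card_union_le _ _).trans (add_le_add ?_ ?_)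
          · refine Finset.card_image_le.trans ?_
            rw [Finset.card_sigma]
            refine (Finset.sum_le_card_nsmul _ _ σ fun e he =>
              hLc e (Finset.mem_filter.1 he).1).trans ?_
            have hau : a ≠ u := fun h => haU (h ▸ hu)
            have := hs.card_filter_superset_le {a, u}
            rw [Finset.card_pair hau] at this
            exact Nat.mul_le_mul_right _ this
          · rcases (A'.filter fun p => a ∈ inc p ∧ p.2 = u).eq_empty_or_nonempty with h | ⟨p, hp⟩
            · simp [h]
            · obtain ⟨hpA, hap, rfl⟩ := Finset.mem_filter.1 hp
              refine le_trans ?_ ((hinc p (hA'A hpA)).2.2 a hap)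
              refine Finset.card_le_card_of_injOn Prod.fst ?_ ?_
              · intro q hq
                obtain ⟨hq, haq, hqp⟩ := Finset.mem_filter.1 hq
                have := hA q (hA'A hq)
                exact Finset.mem_filter.2 ⟨this.1, (hinc q (hA'A hq)).1 haq, hqp ▸ this.2⟩
              · intro q hq q' hq' h
                exact Prod.ext h ((Finset.mem_filter.1 hq).2.2.trans
                  (Finset.mem_filter.1 hq').2.2.symm)
        · exact Nat.mul_le_mul_right _ hU
      obtain ⟨heA, ha⟩ := Finset.mem_filter.1 he
      obtain ⟨b', hi, hab⟩ := hpair heA ha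
      obtain ⟨heD, hvL⟩ := hA _ (hA'A heA)
      have hae : a ∈ e := (hinc _ (hA'A heA)).1 ha
      have heU : ∀ u ∈ U, u ∉ e := fun u hu hue => hev <| Finset.mem_biUnion.2 ⟨u, hu,
        Finset.mem_union_left _ <| Finset.mem_image.2 ⟨⟨e, v⟩, Finset.mem_sigma.2
          ⟨Finset.mem_filter.2 ⟨heD, by simp [Finset.insert_subset_iff, hae, hue]⟩, hvL⟩, rfl⟩⟩
      have hvU : v ∉ U := fun hv => hev <| Finset.mem_biUnion.2 ⟨v, hv,
        Finset.mem_union_right _ <| Finset.mem_filter.2 ⟨heA, ha, rfl⟩⟩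
      have hb'e : b' ∈ e := (hinc _ (hA'A heA)).1 (by simp [hi])
      refine ⟨b', _, ⟨e, v, heA, hi, hab, rfl⟩, fun h => heU _ h hb'e, ?_⟩
      rw [Finset.disjoint_insert_left]
      exact ⟨hvU, Finset.disjoint_left.2 fun w hw hwU => heU w hwU (Finset.mem_sdiff.1 hw).1⟩) (by
      obtain ⟨⟨e, v⟩, he⟩ := Finset.nonempty_iff_ne_empty.2 hne
      obtain ⟨a, b, hab, hi⟩ := Finset.card_eq_two.1 (hinc _ (hA'A he)).2.1
      exact ⟨a, b, _, e, v, he, hi, hab, rfl⟩)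
  refine containsCopy_expansion (φ := φ) (T := fun e => T e) h1 ?_ (fun e v => h2 e v)
    (fun e e' h => h3 _ _ (Subtype.coe_injective.ne h)) (fun x y h => ?_)
  · rintro ⟨e, he⟩
    induction e using Sym2.ind with
    | _ x y => exact hPcard (h5 x y he)
  · obtain ⟨e, v, he, hi, hab, hT⟩ := h5 x y h
    have h1 := hinc _ (hA'A he)
    have h2 := hA _ (hA'A he)
    rw [hi] at h1
    dsimp only
    rw [hT, Finset.insert_comm (φ y), Finset.insert_comm (φ x), Finset.insert_eq (φ x),
      Finset.insert_eq (φ y), ← Finset.union_assoc, ← Finset.insert_eq (φ x) {φ y},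
      Finset.union_sdiff_of_subset h1.1]
    exact hLH _ h2.1 _ h2.2

/-- If all sets of `D` have the same `σ` completions, and `D` is large, then a full part of `D`
together with these `σ` vertices, which play the role of a minimum crosscut, yields a copy. -/
theorem card_le_of_not_containsCopy_of_common_completions {V W : Type*} [Fintype V] [Fintype W] [DecidableEq W]
    {G : SimpleGraph V} (hG : G.IsAcyclic) {r : ℕ} (hr : 3 ≤ r) {D H : Finset (Finset W)}
    (hs : (D : Set (Finset W)).Sized (r - 1)) {X : Finset W}
    (hX : X.card = crosscutNumber (expansion r G)) (hXD : ∀ e ∈ D, ∀ v ∈ X, v ∉ e)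
    (hXH : ∀ e ∈ D, ∀ v ∈ X, insert v e ∈ H) (hH : ¬ ContainsCopy (expansion r G) H) :
    D.card ≤ (Fintype.card V + Nat.card G.edgeSet * (r - 1)) * Fintype.card W ^ (r - 2) := by
  classical
  obtain ⟨D', hD', hfull, hcard⟩ :=
    exists_isFull (Fintype.card V + Nat.card G.edgeSet * (r - 1)) D
  have hsh : D.shadow.card ≤ Fintype.card W ^ (r - 2) := by
    have := (hs.shadow).card_le
    exact this.trans (Nat.choose_le_pow _ _)
  obtain ⟨X₀, hX₀, hX₀card⟩ := Nat.sInf_mem (s := {k | ∃ X, IsCrosscut (expansion r G) X ∧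
    X.card = k}) (by obtain ⟨X, hX⟩ := exists_isCrosscut_expansion hr G; exact ⟨_, X, hX, rfl⟩)
  suffices h : D' = ∅ by
    rw [h, Finset.card_empty, zero_add] at hcard
    exact hcard.trans (Nat.mul_le_mul_left _ hsh)
  by_contra hne
  apply hH
  have hne := Finset.nonempty_iff_ne_empty.2 hne
  have hW : Nonempty W := by
    obtain ⟨E, hE⟩ := hne
    obtain ⟨a, -⟩ : E.Nonempty := Finset.card_pos.1 (by rw [hs (hD' hE)]; omega)
    exact ⟨a⟩
  let ψ₀ : X₀ ≃ X := Finset.equivOfCardEq (hX₀card.trans hX.symm)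
  let ψ : V ⊕ (G.edgeSet × Fin (r - 2)) → W :=
    fun x => if h : x ∈ X₀ then ψ₀ ⟨x, h⟩ else Classical.arbitrary W
  have hψ : ∀ x (h : x ∈ X₀), ψ x = ψ₀ ⟨x, h⟩ := fun x h => dif_pos h
  have hψX : ∀ x ∈ X₀, ψ x ∈ X := fun x h => by rw [hψ x h]; exact (ψ₀ ⟨x, h⟩).2
  refine hfull.containsCopy_expansion_of_isCrosscut hG hr
    (fun E hE => hs (hD' hE)) hne le_rfl hX₀ (ψ := ψ) ?_
    (fun E hE x hx => hXD E (hD' hE) _ (hψX x hx)) (fun E hE x hx => hXH E (hD' hE) _ (hψX x hx))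
  intro x hx y hy hxy
  rw [hψ x hx, hψ y hy] at hxy
  simpa using ψ₀.injective (Subtype.ext hxy)

/-- There are three kinds of sets `e ∈ D`, where `Q` is the set of the heavy pairs `(a, v)`, those for which
`v` completes more than `η` of the sets of `D` that contain `a`, and `S` is the set of the vertices
`v` in more than `γ` heavy pairs: some `v ∈ L e` is light with two vertices of `e`; or some
`v ∈ L e` outside `S` is heavy with two vertices of `e`; or `L e ⊆ S`. They give the three terms of
the bound: greedy embedding bounds the first kind, counting pairs of heavy pairs `(a, v)`, `(b, v)`
the second, and the crosscut embedding, for each possible `L e`, the third. -/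
theorem card_le_of_not_containsCopy {V W : Type*} [Fintype V] [Fintype W] [DecidableEq W]
    {G : SimpleGraph V} (hG : G.IsAcyclic) {r : ℕ} (hr : 4 ≤ r) (η γ : ℕ) {D H : Finset (Finset W)}
    (hs : (D : Set (Finset W)).Sized (r - 1)) {L : Finset W → Finset W}
    (hLc : ∀ e ∈ D, (L e).card = crosscutNumber (expansion r G))
    (hLd : ∀ e ∈ D, ∀ v ∈ L e, v ∉ e) (hLH : ∀ e ∈ D, ∀ v ∈ L e, insert v e ∈ H)
    (hH : ¬ ContainsCopy (expansion r G) H) :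
    ∃ (Q : Finset (W × W)) (S : Finset W),
      (η + 1) * Q.card ≤ Fintype.card W ^ (r - 1) * ((r - 1) * crosscutNumber (expansion r G)) ∧
      (γ + 1) * S.card ≤ Q.card ∧
      D.card ≤ (Fintype.card V + Nat.card (Sym2 V) * (r - 2)) *
          (Fintype.card W ^ (r - 3) * crosscutNumber (expansion r G) + η) * Fintype.card W +
        Q.card * (γ * Fintype.card W ^ (r - 3)) +
        2 ^ S.card *
          ((Fintype.card V + Nat.card G.edgeSet * (r - 1)) * Fintype.card W ^ (r - 2)) := by
  set σ := crosscutNumber (expansion r G) with hσ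
  let deg : W → W → ℕ := fun a v => (D.filter fun e => a ∈ e ∧ v ∈ L e).card
  let Q : Finset (W × W) := Finset.univ.filter fun p => η < deg p.1 p.2
  let S : Finset W := Finset.univ.filter fun v => γ < (Q.filter fun p => p.2 = v).card
  refine ⟨Q, S, ?_, ?_, ?_⟩
  · calc (η + 1) * Q.card = ∑ p ∈ Q, (η + 1) := by simp [mul_comm]
      _ ≤ ∑ p ∈ Q, deg p.1 p.2 := Finset.sum_le_sum fun p hp => (Finset.mem_filter.1 hp).2
      _ ≤ ∑ p : W × W, deg p.1 p.2 :=
        Finset.sum_le_sum_of_subset_of_nonneg (Finset.subset_univ _) (by simp)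
      _ = ∑ e ∈ D, (e ×ˢ L e).card := by
        simp only [deg, Finset.card_eq_sum_ones, Finset.sum_filter]
        rw [Finset.sum_comm]
        refine Finset.sum_congr rfl fun e _ => ?_
        rw [← Finset.sum_filter]
        refine Finset.sum_congr ?_ fun _ _ => rfl
        ext p
        simp
      _ = D.card * ((r - 1) * σ) := by
        rw [Finset.sum_const_nat]
        intro e he
        rw [Finset.card_product, hs he, hLc e he]
      _ ≤ _ := Nat.mul_le_mul_right _ (by simpa using hs.card_filter_superset_le ∅)
  · calc (γ + 1) * S.card = ∑ v ∈ S, (γ + 1) := by simp [mul_comm]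
      _ ≤ ∑ v ∈ S, (Q.filter fun p => p.2 = v).card :=
        Finset.sum_le_sum fun v hv => (Finset.mem_filter.1 hv).2
      _ ≤ ∑ v : W, (Q.filter fun p => p.2 = v).card :=
        Finset.sum_le_sum_of_subset_of_nonneg (Finset.subset_univ _) (by simp)
      _ = Q.card := (Finset.card_eq_sum_card_fiberwise (by simp)).symm
  · let A : Finset (Finset W × W) := (D ×ˢ Finset.univ).filter fun p =>
      p.2 ∈ L p.1 ∧ ∃ a ∈ p.1, ∃ b ∈ p.1, a ≠ b ∧ deg a p.2 ≤ η ∧ deg b p.2 ≤ η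
    have hAinc : ∀ p ∈ A, ∃ I : Finset W, I ⊆ p.1 ∧ I.card = 2 ∧ ∀ a ∈ I, deg a p.2 ≤ η := by
      intro p hp
      obtain ⟨-, -, a, ha, b, hb, hab, h⟩ := Finset.mem_filter.1 hp
      exact ⟨{a, b}, by simp [Finset.insert_subset_iff, ha, hb], Finset.card_pair hab,
        by simpa using h⟩
    choose! inc hinc using hAinc
    -- the terms bounded by `hA`, `hB` and `hC` belong to the three kinds of sets
    have hA := card_le_of_not_containsCopy_of_light hG (by omega) hs (fun e he => (hLc e he).le)
      hLd hLH (A := A) (inc := inc) (fun p hp => by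
        have := Finset.mem_filter.1 hp
        exact ⟨(Finset.mem_product.1 this.1).1, this.2.1⟩) hinc hH
    have hB : ((Q.filter fun p => p.2 ∉ S).biUnion fun p =>
        (((Q.filter fun q => q.2 = p.2).image Prod.fst).erase p.1).biUnion fun b =>
          D.filter (({p.1, b} : Finset W) ⊆ ·)).card ≤
        Q.card * (γ * Fintype.card W ^ (r - 3)) := by
      refine Finset.card_biUnion_le.trans ((Finset.sum_le_card_nsmul _ _
        (γ * Fintype.card W ^ (r - 3)) ?_).trans
        (Nat.mul_le_mul_right _ (Finset.card_filter_le _ _)))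
      intro p hp
      have hpS : (Q.filter fun q => q.2 = p.2).card ≤ γ := by
        simpa [S] using (Finset.mem_filter.1 hp).2
      refine Finset.card_biUnion_le.trans ((Finset.sum_le_card_nsmul _ _
        (Fintype.card W ^ (r - 3)) ?_).trans (Nat.mul_le_mul_right _ ?_))
      · intro b hb
        have := hs.card_filter_superset_le {p.1, b}
        rwa [Finset.card_pair (Finset.ne_of_mem_erase hb).symm] at this
      · exact (Finset.card_le_card (Finset.erase_subset _ _)).trans
          (Finset.card_image_le.trans hpS)
    have hC : (S.powerset.biUnion fun X => D.filter fun e => L e = X).card ≤ 2 ^ S.card *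
        ((Fintype.card V + Nat.card G.edgeSet * (r - 1)) * Fintype.card W ^ (r - 2)) := by
      refine Finset.card_biUnion_le.trans ((Finset.sum_le_card_nsmul _ _
        ((Fintype.card V + Nat.card G.edgeSet * (r - 1)) * Fintype.card W ^ (r - 2)) ?_).trans
        (by rw [Finset.card_powerset, smul_eq_mul]))
      intro X _
      rcases (D.filter fun e => L e = X).eq_empty_or_nonempty with h | ⟨e₀, he₀⟩
      · simp [h]
      · obtain ⟨heD, rfl⟩ := Finset.mem_filter.1 he₀
        refine card_le_of_not_containsCopy_of_common_completions hG (by omega)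
          (fun e he => hs (Finset.mem_filter.1 he).1) (hLc _ heD) ?_ ?_ hH
        · intro e he v hv
          obtain ⟨he, h⟩ := Finset.mem_filter.1 he
          exact hLd e he v (h ▸ hv)
        · intro e he v hv
          obtain ⟨he, h⟩ := Finset.mem_filter.1 he
          exact hLH e he v (h ▸ hv)
    refine (Finset.card_le_card (t := A.image Prod.fst ∪ _ ∪ _) ?_).trans
      ((Finset.card_union_le _ _).trans (add_le_add ((Finset.card_union_le _ _).trans
        (add_le_add (Finset.card_image_le.trans hA) hB)) hC))
    intro e he
    by_cases hLS : L e ⊆ S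
    · exact Finset.mem_union_right _ (Finset.mem_biUnion.2 ⟨L e, Finset.mem_powerset.2 hLS,
        Finset.mem_filter.2 ⟨he, rfl⟩⟩)
    refine Finset.mem_union_left _ ?_
    obtain ⟨v, hv, hvS⟩ := Finset.not_subset.1 hLS
    by_cases hlight : 1 < (e.filter fun a => deg a v ≤ η).card
    · obtain ⟨a, ha, b, hb, hab⟩ := Finset.one_lt_card.1 hlight
      rw [Finset.mem_filter] at ha hb
      exact Finset.mem_union_left _ (Finset.mem_image.2 ⟨(e, v), Finset.mem_filter.2
        ⟨by simp [he], hv, a, ha.1, b, hb.1, hab, ha.2, hb.2⟩, rfl⟩)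
    · -- here the uniformity `r - 1 ≥ 3` of `D` is used: two vertices of `e` are heavy
      have hcard := Finset.card_filter_add_card_filter_not (s := e) (fun a => deg a v ≤ η)
      rw [hs he] at hcard
      obtain ⟨a, ha, b, hb, hab⟩ := Finset.one_lt_card.1
        (show 1 < (e.filter fun a => ¬ deg a v ≤ η).card by omega)
      rw [Finset.mem_filter, not_le] at ha hb
      have hQ : ∀ {c}, η < deg c v → (c, v) ∈ Q := fun h => Finset.mem_filter.2 ⟨by simp, h⟩
      refine Finset.mem_union_right _ (Finset.mem_biUnion.2 ⟨(a, v), Finset.mem_filter.2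
        ⟨hQ ha.2, hvS⟩, Finset.mem_biUnion.2 ⟨b, Finset.mem_erase.2 ⟨hab.symm, Finset.mem_image.2
          ⟨(b, v), Finset.mem_filter.2 ⟨hQ hb.2, rfl⟩, rfl⟩⟩, Finset.mem_filter.2 ⟨he, ?_⟩⟩⟩)
      simp [Finset.insert_subset_iff, ha.1, hb.1]

/-- If each set of `D` has `σ` completions to an edge of a hypergraph that contains no copy of the
expansion, then `D` has only `o(n ^ (r - 1))` sets. -/
theorem exists_card_le_of_not_containsCopy {V : Type*} [Fintype V] {G : SimpleGraph V}
    (hG : G.IsAcyclic) {r : ℕ} (hr : 4 ≤ r) {δ : ℝ} (hδ : 0 < δ) :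
    ∃ C : ℝ, ∀ (n : ℕ) (D H : Finset (Finset (Fin n))) (L : Finset (Fin n) → Finset (Fin n)),
      0 < n → (D : Set (Finset (Fin n))).Sized (r - 1) →
      (∀ e ∈ D, (L e).card = crosscutNumber (expansion r G)) →
      (∀ e ∈ D, ∀ v ∈ L e, v ∉ e) → (∀ e ∈ D, ∀ v ∈ L e, insert v e ∈ H) →
      ¬ ContainsCopy (expansion r G) H →
      (D.card : ℝ) ≤ δ * n ^ (r - 1) + C * n ^ (r - 2) := by
  set σ := crosscutNumber (expansion r G) with hσ
  set M := Fintype.card V + Nat.card (Sym2 V) * (r - 2) with hM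
  set M' := Fintype.card V + Nat.card G.edgeSet * (r - 1) with hM'
  -- heavy pairs have degree more than `α n ^ (r - 2)`; vertices of `S` are in more than `β n` of them
  obtain ⟨α, hα, hαδ⟩ : ∃ α : ℝ, 0 < α ∧ M * α ≤ δ / 2 := by
    refine ⟨δ / (2 * (M + 1)), by positivity, ?_⟩
    rw [mul_div_assoc', div_le_div_iff₀ (by positivity) (by positivity)]
    nlinarith
  set q : ℝ := ((r - 1 : ℕ) * σ : ℕ) / α with hq
  have hq0 : 0 ≤ q := by positivity
  obtain ⟨β, hβ, hβδ⟩ : ∃ β : ℝ, 0 < β ∧ q * β ≤ δ / 2 := by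
    refine ⟨δ / (2 * (q + 1)), by positivity, ?_⟩
    rw [mul_div_assoc', div_le_div_iff₀ (by positivity) (by positivity)]
    nlinarith
  refine ⟨M * σ + 2 ^ ⌊q / β⌋₊ * M', fun n D H L hn hs hLc hLd hLH hH => ?_⟩
  obtain ⟨Q, S, hQ, hS, hD⟩ := card_le_of_not_containsCopy hG hr ⌊α * n ^ (r - 2)⌋₊ ⌊β * n⌋₊
    hs hLc hLd hLH hH
  rw [Fintype.card_fin] at hQ hD
  rw [← hσ] at hQ hD
  rw [← hM, ← hM'] at hD
  have hn' : (0 : ℝ) < n := by exact_mod_cast hn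
  have hpow1 : (n : ℝ) ^ (r - 1) = n ^ (r - 2) * n := by
    rw [← pow_succ]; congr 1; omega
  have hpow2 : (n : ℝ) ^ (r - 2) = n ^ (r - 3) * n := by
    rw [← pow_succ]; congr 1; omega
  have hQ' : (Q.card : ℝ) ≤ q * n := by
    have h1 : α * n ^ (r - 2) * Q.card ≤ n ^ (r - 1) * ((r - 1 : ℕ) * σ : ℕ) :=
      (mul_le_mul_of_nonneg_right (Nat.lt_floor_add_one _).le (by positivity)).trans
        (by exact_mod_cast hQ)
    rw [hq, div_mul_eq_mul_div, le_div_iff₀ hα]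
    rw [hpow1] at h1
    have hp : (0 : ℝ) < n ^ (r - 2) := by positivity
    refine le_of_mul_le_mul_left ?_ hp
    linarith
  have hS' : S.card ≤ ⌊q / β⌋₊ := by
    refine Nat.le_floor ?_
    have h1 : β * n * S.card ≤ Q.card :=
      (mul_le_mul_of_nonneg_right (Nat.lt_floor_add_one _).le (by positivity)).trans
        (by exact_mod_cast hS)
    rw [le_div_iff₀ hβ]
    refine le_of_mul_le_mul_left ?_ hn'
    linarith
  have hη : (⌊α * n ^ (r - 2)⌋₊ : ℝ) ≤ α * n ^ (r - 2) := Nat.floor_le (by positivity)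
  have hγ : (⌊β * n⌋₊ : ℝ) ≤ β * n := Nat.floor_le (by positivity)
  calc (D.card : ℝ) ≤ M * (n ^ (r - 3) * σ + ⌊α * n ^ (r - 2)⌋₊) * n +
        Q.card * (⌊β * n⌋₊ * n ^ (r - 3)) + 2 ^ S.card * (M' * n ^ (r - 2)) := by
        exact_mod_cast hD
    _ ≤ M * (n ^ (r - 3) * σ + α * n ^ (r - 2)) * n +
        q * n * (β * n * n ^ (r - 3)) + 2 ^ ⌊q / β⌋₊ * (M' * n ^ (r - 2)) := by
        gcongr
        norm_num
    _ = (M * α + q * β) * n ^ (r - 1) + (M * σ + 2 ^ ⌊q / β⌋₊ * M') * n ^ (r - 2) := by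
        rw [hpow1, hpow2]; ring
    _ ≤ δ * n ^ (r - 1) + (M * σ + 2 ^ ⌊q / β⌋₊ * M') * n ^ (r - 2) := by
        gcongr
        linarith

/-! ### The upper bound -/

theorem crosscutNumber_expansion_pos {r : ℕ} (hr : 3 ≤ r) {V : Type*} [Fintype V]
    {G : SimpleGraph V} (hne : G ≠ ⊥) : 0 < crosscutNumber (expansion r G) := by
  classical
  obtain ⟨X, hX, hXc⟩ := Nat.sInf_mem (s := {k | ∃ X, IsCrosscut (expansion r G) X ∧
    X.card = k}) (by obtain ⟨X, hX⟩ := exists_isCrosscut_expansion hr G; exact ⟨_, X, hX, rfl⟩)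
  obtain ⟨x, y, h⟩ := SimpleGraph.ne_bot_iff_exists_adj.1 hne
  obtain ⟨z, ⟨-, hz⟩, -⟩ := hX _ (Finset.mem_image_of_mem _ (Finset.mem_univ ⟨s(x, y), h⟩))
  exact (Finset.card_pos.2 ⟨z, hz⟩).trans_eq hXc

/-- Peeling off the `(r - 1)`-sets of codegree less than `σ` costs the main term; the edges that
remain are few, since they number `O(|D|)` for their shadow `D`, all of whose sets have `σ`
completions. -/
theorem exists_card_le_of_free {V : Type*} [Fintype V] {G : SimpleGraph V}
    (hG : G.IsAcyclic) (hne : G ≠ ⊥) {r : ℕ} (hr : 4 ≤ r) {δ : ℝ} (hδ : 0 < δ) :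
    ∃ C : ℝ, ∀ (n : ℕ) (H : Finset (Finset (Fin n))), 0 < n →
      (H : Set (Finset (Fin n))).Sized r → ¬ ContainsCopy (expansion r G) H →
      (H.card : ℝ) ≤ ((crosscutNumber (expansion r G) : ℝ) - 1) * n.choose (r - 1) +
        (δ * n ^ (r - 1) + C * n ^ (r - 2)) := by
  set σ := crosscutNumber (expansion r G) with hσ
  have hσ0 : 0 < σ := crosscutNumber_expansion_pos (by omega) hne
  set M := Fintype.card V + Nat.card (Sym2 V) * (r - 2) with hM
  obtain ⟨C, hC⟩ := exists_card_le_of_not_containsCopy hG hr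
    (show (0 : ℝ) < δ / (M + 1) by positivity)
  refine ⟨M * C, fun n H hn hs hH => ?_⟩
  obtain ⟨H', hH'H, hfull, hcard⟩ := exists_isFull (σ - 1) H
  obtain ⟨H'', hH''H', hfull', hcard'⟩ := exists_isFull M H'
  have hs' : (H' : Set (Finset (Fin n))).Sized r := fun E hE => hs (hH'H hE)
  have hmono : ∀ H₁ ⊆ H, ¬ ContainsCopy (expansion r G) H₁ :=
    fun H₁ hH₁ ⟨f, hf⟩ => hH ⟨f, fun e he => hH₁ (hf e he)⟩
  -- more than `M * |∂H'|` edges would leave a non-empty `M`-full hypergraph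
  have hH'' : H'' = ∅ := by
    by_contra h
    exact hmono H'' (hH''H'.trans hH'H) (hfull'.containsCopy_expansion hG (by omega)
      (fun E hE => hs' (hH''H' hE)) (Finset.nonempty_iff_ne_empty.2 h) le_rfl)
  rw [hH'', Finset.card_empty, zero_add] at hcard'
  have hsh : H.shadow.card ≤ n.choose (r - 1) := by simpa using hs.shadow.card_le
  have hL : ∀ e ∈ H'.shadow, ∃ L : Finset (Fin n), L.card = σ ∧
      ∀ v ∈ L, v ∉ e ∧ insert v e ∈ H' := by
    intro e he
    obtain ⟨E, hE, u, hu, rfl⟩ := Finset.mem_shadow_iff.1 he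
    have hlt := hfull E hE u hu
    obtain ⟨L, hL, hLc⟩ := Finset.exists_subset_card_eq (n := σ)
      (s := Finset.univ.filter fun v => v ∉ E.erase u ∧ insert v (E.erase u) ∈ H') (by
        refine le_trans (show σ ≤ (H'.filter (E.erase u ⊆ ·)).card by omega) ((Finset.card_le_card (t := Finset.image
          (fun v => insert v (E.erase u)) _) fun E' hE' => ?_).trans Finset.card_image_le)
        obtain ⟨hE', hsub⟩ := Finset.mem_filter.1 hE'
        obtain ⟨w, hw⟩ : ∃ w, E' \ E.erase u = {w} := by
          rw [← Finset.card_eq_one, Finset.card_sdiff_of_subset hsub, Finset.card_erase_of_mem hu,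
            hs' hE', hs' hE]
          omega
        have hE'eq : insert w (E.erase u) = E' := by
          rw [Finset.insert_eq, ← hw, Finset.sdiff_union_of_subset hsub]
        have hwE : w ∈ E' \ E.erase u := by simp [hw]
        exact Finset.mem_image.2 ⟨w, Finset.mem_filter.2 ⟨Finset.mem_univ _,
          (Finset.mem_sdiff.1 hwE).2, hE'eq ▸ hE'⟩, hE'eq⟩)
    exact ⟨L, hLc, fun v hv => (Finset.mem_filter.1 (hL hv)).2⟩
  choose! L hLc hL using hL
  have hD := hC n H'.shadow H' L hn hs'.shadow hLc (fun e he v hv => (hL e he v hv).1)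
    (fun e he v hv => (hL e he v hv).2) (hmono H' hH'H)
  have hpow : (0 : ℝ) ≤ n ^ (r - 1) := by positivity
  have hMδ : M * (δ / (M + 1)) ≤ δ := by
    rw [mul_div_assoc', div_le_iff₀ (by positivity)]
    nlinarith
  calc (H.card : ℝ) ≤ H'.card + (σ - 1 : ℕ) * H.shadow.card := by exact_mod_cast hcard
    _ ≤ M * H'.shadow.card + (σ - 1 : ℕ) * n.choose (r - 1) := by
      gcongr
      exact_mod_cast hcard'
    _ ≤ M * (δ / (M + 1) * n ^ (r - 1) + C * n ^ (r - 2)) + (σ - 1 : ℕ) * n.choose (r - 1) := by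
      gcongr
    _ = M * (δ / (M + 1)) * n ^ (r - 1) + M * C * n ^ (r - 2) +
        (σ - 1 : ℕ) * n.choose (r - 1) := by ring
    _ ≤ δ * n ^ (r - 1) + M * C * n ^ (r - 2) + (σ - 1 : ℕ) * n.choose (r - 1) := by gcongr
    _ = _ := by
      rw [Nat.cast_pred hσ0]
      ring

/-! ### The lower bound -/

/-- A hypergraph all of whose edges meet `A` in exactly one vertex contains no copy of a hypergraph
with a larger crosscut number: the vertices mapped into `A` would form a crosscut. -/
theorem crosscutNumber_le_of_containsCopy {U W : Type*} [Finite U] {F : Finset (Finset U)}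
    {H : Finset (Finset W)} {A : Finset W} (hA : ∀ E ∈ H, ∃! a, a ∈ E ∧ a ∈ A)
    (h : ContainsCopy F H) : crosscutNumber F ≤ A.card := by
  classical
  have := Fintype.ofFinite U
  obtain ⟨f, hf⟩ := h
  refine le_trans (Nat.sInf_le ⟨Finset.univ.filter (f · ∈ A), fun e he => ?_, rfl⟩) ?_
  · obtain ⟨a, ⟨hae, haA⟩, huniq⟩ := hA _ (hf e he)
    obtain ⟨x, hx, rfl⟩ := Finset.mem_map.1 hae
    refine ⟨x, ⟨hx, by simpa using haA⟩, fun y hy => f.injective ?_⟩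
    exact huniq _ ⟨Finset.mem_map_of_mem f hy.1, by simpa using hy.2⟩
  · exact Finset.card_le_card_of_injOn f (fun x hx => (Finset.mem_filter.1 hx).2) f.injective.injOn

/-- The `r`-sets that meet a fixed `k`-set in exactly one vertex, for `k` less than the crosscut
number. The second term on the right accounts for the `(r - 1)`-sets that meet the `k`-set. -/
theorem le_turanNumber {U : Type*} [Finite U] {F : Finset (Finset U)} {r k n : ℕ} (hr : 2 ≤ r)
    (hk : k < crosscutNumber F) (hn : k ≤ n) :
    k * n.choose (r - 1) ≤ turanNumber r n F + k * (k * n ^ (r - 2)) := by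
  classical
  obtain ⟨A, -, hA⟩ := Finset.exists_subset_card_eq (s := (Finset.univ : Finset (Fin n)))
    (by simpa using hn)
  let H : Finset (Finset (Fin n)) :=
    (A ×ˢ Finset.powersetCard (r - 1) Aᶜ).image fun p => insert p.1 p.2
  have hinter : ∀ p ∈ A ×ˢ Finset.powersetCard (r - 1) Aᶜ, p.1 ∈ A ∧ p.2.card = r - 1 ∧
      Disjoint p.2 A := by
    intro p hp
    rw [Finset.mem_product, Finset.mem_powersetCard, Finset.subset_compl_iff_disjoint_right] at hp
    exact ⟨hp.1, hp.2.2, hp.2.1⟩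
  have hcardH : H.card = k * (Aᶜ.card).choose (r - 1) := by
    rw [Finset.card_image_of_injOn, Finset.card_product, Finset.card_powersetCard, hA]
    rintro ⟨a, e⟩ hp ⟨a', e'⟩ hp' h
    obtain ⟨ha, -, he⟩ := hinter _ hp
    obtain ⟨ha', -, he'⟩ := hinter _ hp'
    dsimp only at h ha he ha' he'
    rw [Finset.disjoint_left] at he he'
    have haa' : a = a' := by
      have : a ∈ insert a' e' := h ▸ Finset.mem_insert_self a e
      rcases Finset.mem_insert.1 this with h | h
      · exact h
      · exact absurd ha (he' h)
    subst haa'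
    have hae : a ∉ e := fun h => he h ha
    have hae' : a ∉ e' := fun h => he' h ha
    rw [← Finset.erase_insert hae, h, Finset.erase_insert hae']
  have hHmem : H ∈ {H ∈ (Finset.powersetCard r (Finset.univ : Finset (Fin n))).powerset |
      ¬ ContainsCopy F H} := by
    rw [Finset.mem_filter, Finset.mem_powerset]
    refine ⟨fun E hE => ?_, fun h => ?_⟩
    · obtain ⟨p, hp, rfl⟩ := Finset.mem_image.1 hE
      obtain ⟨h1, h2, h3⟩ := hinter p hp
      rw [Finset.mem_powersetCard_univ, Finset.card_insert_of_notMem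
        (fun h => Finset.disjoint_left.1 h3 h h1), h2]
      omega
    · refine absurd (crosscutNumber_le_of_containsCopy (A := A) ?_ h) (by omega)
      intro E hE
      obtain ⟨p, hp, rfl⟩ := Finset.mem_image.1 hE
      obtain ⟨h1, h2, h3⟩ := hinter p hp
      refine ⟨p.1, ⟨Finset.mem_insert_self _ _, h1⟩, fun a ha => ?_⟩
      exact (Finset.mem_insert.1 ha.1).resolve_right fun h => Finset.disjoint_left.1 h3 h ha.2
  have hle : H.card ≤ turanNumber r n F := by
    unfold turanNumber
    convert Finset.le_sup (f := Finset.card) hHmem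
  -- at most `k * n ^ (r - 2)` of the `(r - 1)`-sets meet `A`
  have hchoose : n.choose (r - 1) ≤ (Aᶜ.card).choose (r - 1) + k * n ^ (r - 2) := by
    have hsized : ((Finset.powersetCard (r - 1) (Finset.univ : Finset (Fin n)) :
        Finset (Finset (Fin n))) : Set (Finset (Fin n))).Sized (r - 1) :=
      fun E hE => (Finset.mem_powersetCard.1 hE).2
    have h1 : Finset.powersetCard (r - 1) (Finset.univ : Finset (Fin n)) ⊆
        Finset.powersetCard (r - 1) Aᶜ ∪ A.biUnion fun a =>
          (Finset.powersetCard (r - 1) Finset.univ).filter (({a} : Finset (Fin n)) ⊆ ·) := by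
      intro e he
      by_cases hd : Disjoint e A
      · exact Finset.mem_union_left _ (Finset.mem_powersetCard.2
          ⟨Finset.subset_compl_iff_disjoint_right.2 hd, (Finset.mem_powersetCard.1 he).2⟩)
      · obtain ⟨a, hae, haA⟩ := Finset.not_disjoint_iff.1 hd
        exact Finset.mem_union_right _ (Finset.mem_biUnion.2 ⟨a, haA, Finset.mem_filter.2
          ⟨he, by simpa using hae⟩⟩)
    have h2 := (Finset.card_le_card h1).trans (Finset.card_union_le _ _)
    rw [Finset.card_powersetCard, Finset.card_powersetCard, Finset.card_univ,
      Fintype.card_fin] at h2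
    refine h2.trans (Nat.add_le_add_left (Finset.card_biUnion_le.trans
      ((Finset.sum_le_card_nsmul _ _ (n ^ (r - 2)) fun a _ => ?_).trans ?_)) _)
    · simpa [Nat.sub_sub] using hsized.card_filter_superset_le {a}
    · rw [hA, smul_eq_mul]
  calc k * n.choose (r - 1) ≤ k * ((Aᶜ.card).choose (r - 1) + k * n ^ (r - 2)) :=
        Nat.mul_le_mul_left _ hchoose
    _ = H.card + k * (k * n ^ (r - 2)) := by rw [hcardH, mul_add]
    _ ≤ _ := Nat.add_le_add_right hle _

/-! ### The asymptotics -/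

theorem theorem4 (r : ℕ) (hr : 4 ≤ r) {V : Type*} [Fintype V] (G : SimpleGraph V)
    (hG : G.IsAcyclic) (hne : G ≠ ⊥) :
    ((fun n : ℕ => (turanNumber r n (expansion r G) : ℝ) -
        ((crosscutNumber (expansion r G) : ℝ) - 1) * (n.choose (r - 1) : ℝ))
      =o[atTop] fun n : ℕ => (n.choose (r - 1) : ℝ)) ∧
    (2 ≤ crosscutNumber (expansion r G) →
      (fun n : ℕ => (turanNumber r n (expansion r G) : ℝ)) ~[atTop]
        fun n : ℕ => ((crosscutNumber (expansion r G) : ℝ) - 1) * (n.choose (r - 1) : ℝ)) := by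
  set σ := crosscutNumber (expansion r G) with hσ
  have hσ0 : 0 < σ := crosscutNumber_expansion_pos (by omega) hne
  have main : (fun n : ℕ => (turanNumber r n (expansion r G) : ℝ) -
      ((σ : ℝ) - 1) * (n.choose (r - 1) : ℝ)) =o[atTop] fun n : ℕ => (n.choose (r - 1) : ℝ) := by
    refine IsLittleO.trans_isTheta ?_ (isTheta_choose (r - 1)).symm
    rw [isLittleO_iff]
    intro c hc
    obtain ⟨C, hC⟩ := exists_card_le_of_free hG hne hr (half_pos hc)
    have hlarge : ∀ C' : ℝ, ∀ᶠ n : ℕ in atTop, C' * n ^ (r - 2) ≤ c / 2 * n ^ (r - 1) := by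
      intro C'
      filter_upwards [(tendsto_natCast_atTop_atTop (R := ℝ)).eventually_ge_atTop (C' / (c / 2))]
        with n hn
      rw [div_le_iff₀ (half_pos hc)] at hn
      rw [show r - 1 = r - 2 + 1 by omega, pow_succ]
      have : (0 : ℝ) ≤ n ^ (r - 2) := by positivity
      nlinarith
    filter_upwards [hlarge C, hlarge ((σ - 1 : ℕ) * (σ - 1 : ℕ)), eventually_ge_atTop (σ - 1),
      eventually_gt_atTop 0] with n h1 h2 h3 h4
    have hnn : (0 : ℝ) ≤ n ^ (r - 1) := by positivity
    rw [Real.norm_eq_abs, Real.norm_of_nonneg hnn, abs_le]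
    constructor
    · have h : ((σ - 1 : ℕ) : ℝ) * n.choose (r - 1) ≤ turanNumber r n (expansion r G) +
          (σ - 1 : ℕ) * ((σ - 1 : ℕ) * n ^ (r - 2)) := by
        exact_mod_cast le_turanNumber (F := expansion r G) (by omega)
          (show σ - 1 < crosscutNumber (expansion r G) by omega) h3
      rw [← mul_assoc] at h
      rw [← Nat.cast_pred hσ0]
      nlinarith
    · have hsup : (turanNumber r n (expansion r G) : ℝ) ≤ ((σ : ℝ) - 1) * n.choose (r - 1) +
          (c / 2 * n ^ (r - 1) + C * n ^ (r - 2)) := by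
        classical
        obtain ⟨H, hH, hHc⟩ := Finset.exists_mem_eq_sup
          {H ∈ (Finset.powersetCard r (Finset.univ : Finset (Fin n))).powerset |
            ¬ ContainsCopy (expansion r G) H} ⟨∅, by
              obtain ⟨x, y, h⟩ := SimpleGraph.ne_bot_iff_exists_adj.1 hne
              refine Finset.mem_filter.2 ⟨by simp, fun ⟨f, hf⟩ => ?_⟩
              simpa using hf _ (Finset.mem_image_of_mem _ (Finset.mem_univ ⟨s(x, y), h⟩))⟩
          Finset.card
        rw [Finset.mem_filter, Finset.mem_powerset] at hH
        have hT : turanNumber r n (expansion r G) = H.card := by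
          rw [← hHc]
          unfold turanNumber
          congr!
        rw [hT]
        exact hC n H h4 (fun E hE => (Finset.mem_powersetCard.1 (hH.1 hE)).2) hH.2
      linarith
  refine ⟨main, fun h2 => ?_⟩
  have hσ1 : (σ : ℝ) - 1 ≠ 0 := by
    have : (2 : ℝ) ≤ σ := by exact_mod_cast h2
    linarith
  exact (isLittleO_const_mul_right_iff hσ1).2 main
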